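/- Let $G$ be a group and let $\{G^{(a)}\}_{a\in I}$ be a family of pairwise non-isomorphic simple finite-dimensional complex $G$-modules containing the trivial module $G^{(0)}\cong\mathbb{C}$ and a module $V=G^{(1)}$ (for example a full set of representatives of the simple $G$-modules). Suppose that for every $a\in I$ the module $V\otimes G^{(a)}$ is isomorphic to a finite direct sum $\bigoplus_{b\in I}(G^{(b)})^{m_{a,b}}$. The representation graph $R(V,G)$ has node set $I$ and $m_{a,b}$ directed edges from $a$ to $b$. Assume that it has no multiple parallel edges, i.e. $m_{a,b}\le 1$ for all $a,b$, and that it is connected: if $I$ is finite, the underlying undirected graph is connected; if $I$ is infinite, every node can be reached from the node $0$ along a directed path. For each edge from $a$ to $b$ fix a non-zero $G$-map $m_{1a}^{b}: V\otimes G^{(a)}\to G^{(b)}$ and a $G$-map $s^{1a}_{b}: G^{(b)}\to V\otimes G^{(a)}$ such that $\sum_{b} s^{1a}_{b}\circ m_{1a}^{b}=\mathrm{id}_{V\otimes G^{(a)}}$ for every $a$ (sum over the edges out of $a$), and fix an isomorphism $G^{(0)}\cong\mathbb{C}$. Let $\mathbf{Dgrams}$ be the $\mathbb{C}$-linear monoidal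 category with objects generated by the nodes $a\in I$ and morphisms generated by a merge $\mu_a^b: 1\otimes a\to b$ and a split $\sigma_a^b: b\to 1\otimes a$ for each edge from $a$ to $b$, together with a pair of mutually inverse morphisms identifying the node $0$ with the unit object, subject to the relations $\mu_a^b\circ\sigma_a^b=\mathrm{id}_b$ for every edge from $a$ to $b$, and $\sum_b\sigma_a^b\circ\mu_a^b=\mathrm{id}_{1\otimes a}$ for every $a$. Let $G\text{-}\mathbf{mod}_{\mathrm{irr}}$ be the full subcategory of the category of finite-dimensional $G$-modules whose objects are the finite tensor products (the empty one included) of the modules $G^{(a)}$, and let $\mathcal{H}:\mathbf{Dgrams}\to G\text{-}\mathbf{mod}_{\mathrm{irr}}$ be the $\mathbb{C}$-linear monoidal functor with $a\mapsto G^{(a)}$, $\mu_a^b\mapsto m_{1a}^b$, $\sigma_a^b\mapsto s^{1a}_b$, and with the identification of $0$ with the unit object sent to the fixed isomorphism $G^{(0)}\cong\mathbb{C}$. Let $\mathcal{I}$ be a tensor ideal of $\mathbf{Dgrams}$ such that $\mathcal{H}(f)=0$ for every morphism $f$ in $\mathcal{I}$ and such that, for all $a,b\in I$, $$\operatorname{Hom}_{\mathbf{Dgrams}/\mathcal{I}}(a,b)=\begin{cases}\mathbb{C}\cdot\mathrm{id}_a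 & a=b,\\ 0 & a\ne b.\end{cases}$$ Then the induced functor $\overline{\mathcal{H}}:\mathbf{Dgrams}/\mathcal{I}\to G\text{-}\mathbf{mod}_{\mathrm{irr}}$ is an equivalence of categories. -/

import Mathlib

open CategoryTheory MonoidalCategory Limits

universe v u w

noncomputable section

namespace RepDiagrams

/-! ### The free `ℂ`-linear monoidal category on objects `O` and morphisms `Gen` -/

/-- Formal tensor products of generating objects. -/
inductive FreeObj (O : Type u) : Type u
  | unit : FreeObj O
  | of (a : O) : FreeObj O
  | tensor (X Y : FreeObj O) : FreeObj O

/-- Formal morphisms: linear combinations, composites and tensor products of the generating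
morphisms, identities, associators and unitors. -/
inductive Term {O : Type u} (Gen : FreeObj O → FreeObj O → Type u) :
    FreeObj O → FreeObj O → Type u
  | gen {X Y} (g : Gen X Y) : Term Gen X Y
  | id (X) : Term Gen X X
  | comp {X Y Z} (f : Term Gen X Y) (g : Term Gen Y Z) : Term Gen X Z
  | tensor {X₁ Y₁ X₂ Y₂} (f : Term Gen X₁ Y₁) (g : Term Gen X₂ Y₂) :
      Term Gen (X₁.tensor X₂) (Y₁.tensor Y₂)
  | assocHom (X Y Z : FreeObj O) : Term Gen ((X.tensor Y).tensor Z) (X.tensor (Y.tensor Z))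
  | assocInv (X Y Z : FreeObj O) : Term Gen (X.tensor (Y.tensor Z)) ((X.tensor Y).tensor Z)
  | leftHom (X : FreeObj O) : Term Gen (FreeObj.unit.tensor X) X
  | leftInv (X : FreeObj O) : Term Gen X (FreeObj.unit.tensor X)
  | rightHom (X : FreeObj O) : Term Gen (X.tensor FreeObj.unit) X
  | rightInv (X : FreeObj O) : Term Gen X (X.tensor FreeObj.unit)
  | zero (X Y) : Term Gen X Y
  | add {X Y} (f g : Term Gen X Y) : Term Gen X Y
  | smul {X Y} (c : ℂ) (f : Term Gen X Y) : Term Gen X Y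

/-- The least congruence on formal morphisms for which the axioms of a `ℂ`-linear monoidal
category hold. -/
inductive Term.Rel {O : Type u} {Gen : FreeObj O → FreeObj O → Type u} :
    ∀ {X Y : FreeObj O}, Term Gen X Y → Term Gen X Y → Prop
  | refl {X Y} (f : Term Gen X Y) : Rel f f
  | symm {X Y} {f g : Term Gen X Y} : Rel f g → Rel g f
  | trans {X Y} {f g h : Term Gen X Y} : Rel f g → Rel g h → Rel f h
  | comp {X Y Z} {f f' : Term Gen X Y} {g g' : Term Gen Y Z} :
      Rel f f' → Rel g g' → Rel (f.comp g) (f'.comp g')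
  | tensor {X₁ Y₁ X₂ Y₂} {f f' : Term Gen X₁ Y₁} {g g' : Term Gen X₂ Y₂} :
      Rel f f' → Rel g g' → Rel (f.tensor g) (f'.tensor g')
  | add {X Y} {f f' g g' : Term Gen X Y} : Rel f f' → Rel g g' → Rel (f.add g) (f'.add g')
  | smul {X Y} (c : ℂ) {f f' : Term Gen X Y} : Rel f f' → Rel (f.smul c) (f'.smul c)
  -- category axioms
  | id_comp {X Y} (f : Term Gen X Y) : Rel ((Term.id X).comp f) f
  | comp_id {X Y} (f : Term Gen X Y) : Rel (f.comp (Term.id Y)) f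
  | assoc {X Y Z W} (f : Term Gen X Y) (g : Term Gen Y Z) (h : Term Gen Z W) :
      Rel ((f.comp g).comp h) (f.comp (g.comp h))
  -- vector space axioms
  | add_assoc {X Y} (f g h : Term Gen X Y) : Rel ((f.add g).add h) (f.add (g.add h))
  | add_comm {X Y} (f g : Term Gen X Y) : Rel (f.add g) (g.add f)
  | zero_add {X Y} (f : Term Gen X Y) : Rel ((Term.zero X Y).add f) f
  | neg_add {X Y} (f : Term Gen X Y) : Rel ((f.smul (-1)).add f) (Term.zero X Y)
  | one_smul {X Y} (f : Term Gen X Y) : Rel (f.smul 1) f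
  | mul_smul {X Y} (c d : ℂ) (f : Term Gen X Y) : Rel (f.smul (c * d)) ((f.smul d).smul c)
  | smul_add {X Y} (c : ℂ) (f g : Term Gen X Y) :
      Rel ((f.add g).smul c) ((f.smul c).add (g.smul c))
  | add_smul {X Y} (c d : ℂ) (f : Term Gen X Y) :
      Rel (f.smul (c + d)) ((f.smul c).add (f.smul d))
  -- bilinearity of composition and of the tensor product
  | add_comp {X Y Z} (f f' : Term Gen X Y) (g : Term Gen Y Z) :
      Rel ((f.add f').comp g) ((f.comp g).add (f'.comp g))
  | comp_add {X Y Z} (f : Term Gen X Y) (g g' : Term Gen Y Z) :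
      Rel (f.comp (g.add g')) ((f.comp g).add (f.comp g'))
  | smul_comp {X Y Z} (c : ℂ) (f : Term Gen X Y) (g : Term Gen Y Z) :
      Rel ((f.smul c).comp g) ((f.comp g).smul c)
  | comp_smul {X Y Z} (c : ℂ) (f : Term Gen X Y) (g : Term Gen Y Z) :
      Rel (f.comp (g.smul c)) ((f.comp g).smul c)
  | add_tensor {X₁ Y₁ X₂ Y₂} (f f' : Term Gen X₁ Y₁) (g : Term Gen X₂ Y₂) :
      Rel ((f.add f').tensor g) ((f.tensor g).add (f'.tensor g))
  | tensor_add {X₁ Y₁ X₂ Y₂} (f : Term Gen X₁ Y₁) (g g' : Term Gen X₂ Y₂) :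
      Rel (f.tensor (g.add g')) ((f.tensor g).add (f.tensor g'))
  | smul_tensor {X₁ Y₁ X₂ Y₂} (c : ℂ) (f : Term Gen X₁ Y₁) (g : Term Gen X₂ Y₂) :
      Rel ((f.smul c).tensor g) ((f.tensor g).smul c)
  | tensor_smul {X₁ Y₁ X₂ Y₂} (c : ℂ) (f : Term Gen X₁ Y₁) (g : Term Gen X₂ Y₂) :
      Rel (f.tensor (g.smul c)) ((f.tensor g).smul c)
  -- monoidal category axioms
  | id_tensor_id (X Y) : Rel ((Term.id X).tensor (Term.id Y)) (Term.id (X.tensor Y))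
  | tensor_comp_tensor {X₁ Y₁ Z₁ X₂ Y₂ Z₂} (f₁ : Term Gen X₁ Y₁) (f₂ : Term Gen X₂ Y₂)
      (g₁ : Term Gen Y₁ Z₁) (g₂ : Term Gen Y₂ Z₂) :
      Rel ((f₁.tensor f₂).comp (g₁.tensor g₂)) ((f₁.comp g₁).tensor (f₂.comp g₂))
  | assoc_hom_inv (X Y Z) : Rel ((Term.assocHom X Y Z).comp (Term.assocInv X Y Z)) (Term.id _)
  | assoc_inv_hom (X Y Z) : Rel ((Term.assocInv X Y Z).comp (Term.assocHom X Y Z)) (Term.id _)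
  | left_hom_inv (X) : Rel ((Term.leftHom X).comp (Term.leftInv X)) (Term.id _)
  | left_inv_hom (X) : Rel ((Term.leftInv X).comp (Term.leftHom X)) (Term.id _)
  | right_hom_inv (X) : Rel ((Term.rightHom X).comp (Term.rightInv X)) (Term.id _)
  | right_inv_hom (X) : Rel ((Term.rightInv X).comp (Term.rightHom X)) (Term.id _)
  | assoc_naturality {X₁ X₂ X₃ Y₁ Y₂ Y₃} (f₁ : Term Gen X₁ Y₁) (f₂ : Term Gen X₂ Y₂)
      (f₃ : Term Gen X₃ Y₃) :
      Rel (((f₁.tensor f₂).tensor f₃).comp (Term.assocHom Y₁ Y₂ Y₃))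
        ((Term.assocHom X₁ X₂ X₃).comp (f₁.tensor (f₂.tensor f₃)))
  | left_naturality {X Y} (f : Term Gen X Y) :
      Rel (((Term.id FreeObj.unit).tensor f).comp (Term.leftHom Y)) ((Term.leftHom X).comp f)
  | right_naturality {X Y} (f : Term Gen X Y) :
      Rel ((f.tensor (Term.id FreeObj.unit)).comp (Term.rightHom Y)) ((Term.rightHom X).comp f)
  | pentagon (W X Y Z) :
      Rel (((Term.assocHom W X Y).tensor (Term.id Z)).comp
          ((Term.assocHom W (X.tensor Y) Z).comp ((Term.id W).tensor (Term.assocHom X Y Z))))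
        ((Term.assocHom (W.tensor X) Y Z).comp (Term.assocHom W X (Y.tensor Z)))
  | triangle (X Y) :
      Rel ((Term.assocHom X FreeObj.unit Y).comp ((Term.id X).tensor (Term.leftHom Y)))
        ((Term.rightHom X).tensor (Term.id Y))

instance Term.setoid {O : Type u} (Gen : FreeObj O → FreeObj O → Type u) (X Y : FreeObj O) :
    Setoid (Term Gen X Y) :=
  ⟨Term.Rel, Term.Rel.refl, Term.Rel.symm, Term.Rel.trans⟩

/-- The free `ℂ`-linear monoidal category with generating objects `O` and generating
morphisms `Gen`. -/
def FreeCat {O : Type u} (_Gen : FreeObj O → FreeObj O → Type u) : Type u := FreeObj O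

namespace FreeCat

variable {O : Type u} {Gen : FreeObj O → FreeObj O → Type u}

instance : Category.{u} (FreeCat Gen) where
  Hom X Y := Quotient (Term.setoid Gen X Y)
  id X := ⟦Term.id X⟧
  comp := Quotient.map₂ Term.comp (fun _ _ hf _ _ hg => Term.Rel.comp hf hg)
  id_comp := by rintro X Y ⟨f⟩; exact Quotient.sound (Term.Rel.id_comp f)
  comp_id := by rintro X Y ⟨f⟩; exact Quotient.sound (Term.Rel.comp_id f)
  assoc := by rintro W X Y Z ⟨f⟩ ⟨g⟩ ⟨h⟩; exact Quotient.sound (Term.Rel.assoc f g h)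

/-- The class of a formal morphism. -/
def homMk {X Y : FreeObj O} (f : Term Gen X Y) :
    Quiver.Hom (V := FreeCat Gen) X Y :=
  Quotient.mk (Term.setoid Gen X Y) f

instance homZero (X Y : FreeCat Gen) : Zero (X ⟶ Y) :=
  ⟨Quotient.mk (Term.setoid Gen X Y) (Term.zero X Y)⟩

instance homAdd (X Y : FreeCat Gen) : Add (X ⟶ Y) :=
  ⟨Quotient.map₂ Term.add (fun _ _ hf _ _ hg => Term.Rel.add hf hg)⟩

instance homNeg (X Y : FreeCat Gen) : Neg (X ⟶ Y) :=
  ⟨Quotient.map (Term.smul (-1)) (fun _ _ hf => Term.Rel.smul _ hf)⟩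

instance homAddCommGroup (X Y : FreeCat Gen) : AddCommGroup (X ⟶ Y) where
  add_assoc := by rintro ⟨f⟩ ⟨g⟩ ⟨h⟩; exact Quotient.sound (Term.Rel.add_assoc f g h)
  add_comm := by rintro ⟨f⟩ ⟨g⟩; exact Quotient.sound (Term.Rel.add_comm f g)
  zero_add := by rintro ⟨f⟩; exact Quotient.sound (Term.Rel.zero_add f)
  add_zero := by
    rintro ⟨f⟩
    exact Quotient.sound (Term.Rel.trans (Term.Rel.add_comm _ _) (Term.Rel.zero_add f))
  neg_add_cancel := by rintro ⟨f⟩; exact Quotient.sound (Term.Rel.neg_add f)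
  nsmul := nsmulRec
  zsmul := zsmulRec

instance homSMul (X Y : FreeCat Gen) : SMul ℂ (X ⟶ Y) where
  smul c := Quotient.map (Term.smul c) (fun _ _ hf => Term.Rel.smul _ hf)

instance homModule (X Y : FreeCat Gen) : Module ℂ (X ⟶ Y) :=
  Module.ofMinimalAxioms
    (by rintro c ⟨f⟩ ⟨g⟩; exact Quotient.sound (Term.Rel.smul_add c f g))
    (by rintro c d ⟨f⟩; exact Quotient.sound (Term.Rel.add_smul c d f))
    (by rintro c d ⟨f⟩; exact Quotient.sound (Term.Rel.mul_smul c d f))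
    (by rintro ⟨f⟩; exact Quotient.sound (Term.Rel.one_smul f))

instance : Preadditive (FreeCat Gen) where
  homGroup := homAddCommGroup
  add_comp := by rintro X Y Z ⟨f⟩ ⟨f'⟩ ⟨g⟩; exact Quotient.sound (Term.Rel.add_comp f f' g)
  comp_add := by rintro X Y Z ⟨f⟩ ⟨g⟩ ⟨g'⟩; exact Quotient.sound (Term.Rel.comp_add f g g')

instance : Linear ℂ (FreeCat Gen) where
  homModule := homModule
  smul_comp := by rintro X Y Z c ⟨f⟩ ⟨g⟩; exact Quotient.sound (Term.Rel.smul_comp c f g)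
  comp_smul := by rintro X Y Z ⟨f⟩ c ⟨g⟩; exact Quotient.sound (Term.Rel.comp_smul c f g)

instance : MonoidalCategoryStruct (FreeCat Gen) where
  tensorObj X Y := FreeObj.tensor X Y
  tensorHom := Quotient.map₂ Term.tensor (fun _ _ hf _ _ hg => Term.Rel.tensor hf hg)
  whiskerLeft X _ _ :=
    Quotient.map (Term.tensor (Term.id X)) (fun _ _ hf => Term.Rel.tensor (Term.Rel.refl _) hf)
  whiskerRight f Y :=
    Quotient.map (fun f => Term.tensor f (Term.id Y))
      (fun _ _ hf => Term.Rel.tensor hf (Term.Rel.refl _)) f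
  tensorUnit := FreeObj.unit
  associator X Y Z :=
    ⟨⟦Term.assocHom X Y Z⟧, ⟦Term.assocInv X Y Z⟧, Quotient.sound (Term.Rel.assoc_hom_inv X Y Z),
      Quotient.sound (Term.Rel.assoc_inv_hom X Y Z)⟩
  leftUnitor X :=
    ⟨⟦Term.leftHom X⟧, ⟦Term.leftInv X⟧, Quotient.sound (Term.Rel.left_hom_inv X),
      Quotient.sound (Term.Rel.left_inv_hom X)⟩
  rightUnitor X :=
    ⟨⟦Term.rightHom X⟧, ⟦Term.rightInv X⟧, Quotient.sound (Term.Rel.right_hom_inv X),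
      Quotient.sound (Term.Rel.right_inv_hom X)⟩

instance : MonoidalCategory (FreeCat Gen) :=
  MonoidalCategory.ofTensorHom
    (id_tensorHom_id := fun X Y => Quotient.sound (Term.Rel.id_tensor_id X Y))
    (id_tensorHom := by rintro X Y Z ⟨f⟩; rfl)
    (tensorHom_id := by rintro X Y ⟨f⟩ Z; rfl)
    (tensorHom_comp_tensorHom := by
      rintro X₁ Y₁ Z₁ X₂ Y₂ Z₂ ⟨f₁⟩ ⟨f₂⟩ ⟨g₁⟩ ⟨g₂⟩
      exact Quotient.sound (Term.Rel.tensor_comp_tensor f₁ f₂ g₁ g₂))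
    (associator_naturality := by
      rintro X₁ X₂ X₃ Y₁ Y₂ Y₃ ⟨f₁⟩ ⟨f₂⟩ ⟨f₃⟩
      exact Quotient.sound (Term.Rel.assoc_naturality f₁ f₂ f₃))
    (leftUnitor_naturality := by
      rintro X Y ⟨f⟩; exact Quotient.sound (Term.Rel.left_naturality f))
    (rightUnitor_naturality := by
      rintro X Y ⟨f⟩; exact Quotient.sound (Term.Rel.right_naturality f))
    (pentagon := fun W X Y Z => Quotient.sound (Term.Rel.pentagon W X Y Z))
    (triangle := fun X Y => Quotient.sound (Term.Rel.triangle X Y))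

theorem whiskerLeft_smul' (X : FreeCat Gen) {Y Z : FreeCat Gen} (c : ℂ) (f : Y ⟶ Z) :
    X ◁ (c • f) = c • (X ◁ f) := by
  obtain ⟨f⟩ := f
  exact Quotient.sound (Term.Rel.tensor_smul c _ f)

theorem smul_whiskerRight' (c : ℂ) {Y Z : FreeCat Gen} (f : Y ⟶ Z) (X : FreeCat Gen) :
    (c • f) ▷ X = c • (f ▷ X) := by
  obtain ⟨f⟩ := f
  exact Quotient.sound (Term.Rel.smul_tensor c f _)

instance : MonoidalPreadditive (FreeCat Gen) where
  whiskerLeft_zero {X Y Z} := by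
    have h := whiskerLeft_smul' X (0 : ℂ) (0 : Y ⟶ Z)
    rwa [zero_smul, zero_smul] at h
  zero_whiskerRight {X Y Z} := by
    have h := smul_whiskerRight' (0 : ℂ) (0 : Y ⟶ Z) X
    rwa [zero_smul, zero_smul] at h
  whiskerLeft_add := by
    rintro X Y Z ⟨f⟩ ⟨g⟩; exact Quotient.sound (Term.Rel.tensor_add _ f g)
  add_whiskerRight := by
    rintro X Y Z ⟨f⟩ ⟨g⟩; exact Quotient.sound (Term.Rel.add_tensor f g _)

instance : MonoidalLinear ℂ (FreeCat Gen) where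
  whiskerLeft_smul := whiskerLeft_smul'
  smul_whiskerRight := smul_whiskerRight'

section Lift

variable {D : Type w} [Category.{v} D] [Preadditive D] [Linear ℂ D] [MonoidalCategory D]

/-- The object assignment of the monoidal functor determined by its values on generators. -/
def liftObj (φ : O → D) : FreeObj O → D
  | .unit => 𝟙_ D
  | .of a => φ a
  | .tensor X Y => liftObj φ X ⊗ liftObj φ Y

/-- The morphism assignment, on formal morphisms, of the `ℂ`-linear monoidal functor determined by
its values on generators. -/
def liftTerm (φ : O → D) (ψ : ∀ {X Y}, Gen X Y → (liftObj φ X ⟶ liftObj φ Y)) :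
    ∀ {X Y}, Term Gen X Y → (liftObj φ X ⟶ liftObj φ Y)
  | _, _, .gen g => ψ g
  | _, _, .id X => 𝟙 (liftObj φ X)
  | _, _, .comp f g => liftTerm φ ψ f ≫ liftTerm φ ψ g
  | _, _, .tensor f g => liftTerm φ ψ f ⊗ₘ liftTerm φ ψ g
  | _, _, .assocHom X Y Z => (α_ (liftObj φ X) (liftObj φ Y) (liftObj φ Z)).hom
  | _, _, .assocInv X Y Z => (α_ (liftObj φ X) (liftObj φ Y) (liftObj φ Z)).inv
  | _, _, .leftHom X => (λ_ (liftObj φ X)).hom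
  | _, _, .leftInv X => (λ_ (liftObj φ X)).inv
  | _, _, .rightHom X => (ρ_ (liftObj φ X)).hom
  | _, _, .rightInv X => (ρ_ (liftObj φ X)).inv
  | _, _, .zero X Y => (0 : liftObj φ X ⟶ liftObj φ Y)
  | _, _, .add f g => liftTerm φ ψ f + liftTerm φ ψ g
  | _, _, .smul c f => c • liftTerm φ ψ f

variable [MonoidalPreadditive D] [MonoidalLinear ℂ D]

theorem liftTerm_rel (φ : O → D) (ψ : ∀ {X Y}, Gen X Y → (liftObj φ X ⟶ liftObj φ Y))
    {X Y : FreeObj O} {f g : Term Gen X Y} (h : Term.Rel f g) :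
    liftTerm φ ψ f = liftTerm φ ψ g := by
  induction h with
  | refl f => rfl
  | symm _ ih => exact ih.symm
  | trans _ _ ih₁ ih₂ => exact ih₁.trans ih₂
  | comp _ _ ih₁ ih₂ => simp only [liftTerm, ih₁, ih₂]
  | tensor _ _ ih₁ ih₂ => simp only [liftTerm, ih₁, ih₂]; rfl
  | add _ _ ih₁ ih₂ => simp only [liftTerm, ih₁, ih₂]
  | smul c _ ih => simp only [liftTerm, ih]
  | add_assoc f g h => simp only [liftTerm, _root_.add_assoc]
  | add_comm f g => simp only [liftTerm]; exact _root_.add_comm _ _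
  | mul_smul c d f => simp only [liftTerm]; exact SemigroupAction.mul_smul _ _ _
  | smul_add c f g => simp only [liftTerm, _root_.smul_add]
  | add_smul c d f => simp only [liftTerm, _root_.add_smul]
  | add_tensor f f' g => simp only [liftTerm, MonoidalPreadditive.add_tensor]; rfl
  | tensor_add f g g' => simp only [liftTerm, MonoidalPreadditive.tensor_add]; rfl
  | smul_tensor c f g => simp [liftTerm, MonoidalCategory.tensorHom_def]; rfl
  | tensor_smul c f g => simp [liftTerm, MonoidalCategory.tensorHom_def]; rfl
  | tensor_comp_tensor f₁ f₂ g₁ g₂ =>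
      simp only [liftTerm]; exact MonoidalCategory.tensorHom_comp_tensorHom _ _ _ _
  | assoc_naturality f₁ f₂ f₃ =>
      simp only [liftTerm]; exact MonoidalCategory.associator_naturality _ _ _
  | _ => simp [liftTerm, liftObj]

/-- The `ℂ`-linear monoidal functor determined by its values on generators. -/
def lift (φ : O → D) (ψ : ∀ {X Y}, Gen X Y → (liftObj φ X ⟶ liftObj φ Y)) : FreeCat Gen ⥤ D where
  obj X := liftObj φ X
  map f := Quotient.lift (liftTerm φ ψ) (fun _ _ h => liftTerm_rel φ ψ h) f
  map_id _ := rfl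
  map_comp := by rintro X Y Z ⟨f⟩ ⟨g⟩; rfl

instance (φ : O → D) (ψ : ∀ {X Y}, Gen X Y → (liftObj φ X ⟶ liftObj φ Y)) :
    (lift φ ψ).Additive where
  map_add := by rintro X Y ⟨f⟩ ⟨g⟩; rfl

instance (φ : O → D) (ψ : ∀ {X Y}, Gen X Y → (liftObj φ X ⟶ liftObj φ Y)) :
    (lift φ ψ).Linear ℂ where
  map_smul := by rintro X Y ⟨f⟩ c; rfl

end Lift

end FreeCat

/-! ### Tensor ideals and quotients by them -/

/-- A tensor ideal of a `ℂ`-linear monoidal category: a subspace of every space of morphisms, stable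
under composition on both sides and under tensoring with objects on both sides. -/
@[ext]
structure TensorIdeal (C : Type w) [Category.{v} C] [Preadditive C] [Linear ℂ C]
    [MonoidalCategory C] where
  hom (X Y : C) : Submodule ℂ (X ⟶ Y)
  comp_mem {X Y Z : C} (f : X ⟶ Y) {g : Y ⟶ Z} (hg : g ∈ hom Y Z) : f ≫ g ∈ hom X Z
  mem_comp {X Y Z : C} {f : X ⟶ Y} (hf : f ∈ hom X Y) (g : Y ⟶ Z) : f ≫ g ∈ hom X Z
  whiskerLeft_mem (X : C) {Y Z : C} {f : Y ⟶ Z} (hf : f ∈ hom Y Z) : X ◁ f ∈ hom (X ⊗ Y) (X ⊗ Z)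
  whiskerRight_mem {Y Z : C} {f : Y ⟶ Z} (hf : f ∈ hom Y Z) (X : C) : f ▷ X ∈ hom (Y ⊗ X) (Z ⊗ X)

namespace TensorIdeal

section

variable {C : Type w} [Category.{v} C] [Preadditive C] [Linear ℂ C] [MonoidalCategory C]

/-- The tensor ideal generated by a family of morphisms. -/
def span (R : ∀ {X Y : C}, (X ⟶ Y) → Prop) : TensorIdeal C where
  hom X Y := ⨅ (J : TensorIdeal C) (_ : ∀ {A B : C} (f : A ⟶ B), R f → f ∈ J.hom A B), J.hom X Y
  comp_mem f g hg := by
    simp only [Submodule.mem_iInf] at hg ⊢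
    exact fun J hJ => J.comp_mem f (hg J hJ)
  mem_comp hf g := by
    simp only [Submodule.mem_iInf] at hf ⊢
    exact fun J hJ => J.mem_comp (hf J hJ) g
  whiskerLeft_mem X _ _ _ hf := by
    simp only [Submodule.mem_iInf] at hf ⊢
    exact fun J hJ => J.whiskerLeft_mem X (hf J hJ)
  whiskerRight_mem hf X := by
    simp only [Submodule.mem_iInf] at hf ⊢
    exact fun J hJ => J.whiskerRight_mem (hf J hJ) X

theorem mem_span_of {R : ∀ {X Y : C}, (X ⟶ Y) → Prop} {X Y : C} {f : X ⟶ Y} (hf : R f) :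
    f ∈ (span R).hom X Y := by
  simp only [span, Submodule.mem_iInf]
  exact fun J hJ => hJ f hf

theorem mem_of_mem_span {R : ∀ {X Y : C}, (X ⟶ Y) → Prop} (J : TensorIdeal C)
    (hJ : ∀ {A B : C} (f : A ⟶ B), R f → f ∈ J.hom A B) {X Y : C} {f : X ⟶ Y}
    (hf : f ∈ (span R).hom X Y) : f ∈ J.hom X Y := by
  simp only [span, Submodule.mem_iInf] at hf
  exact hf J hJ

/-- The quotient of a `ℂ`-linear monoidal category by a tensor ideal: the same objects, and the
quotient spaces as spaces of morphisms. -/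
structure Quot (I : TensorIdeal C) where
  as : C

variable {I : TensorIdeal C}

instance : Category.{v} I.Quot where
  Hom X Y := (X.as ⟶ Y.as) ⧸ I.hom X.as Y.as
  id X := Submodule.Quotient.mk (𝟙 X.as)
  comp {X Y Z} f g := Quotient.liftOn₂' f g
    (fun f g => (Submodule.Quotient.mk (f ≫ g) : (X.as ⟶ Z.as) ⧸ I.hom X.as Z.as)) (by
      intro f g f' g' hf hg
      rw [Submodule.quotientRel_def] at hf hg
      refine (Submodule.Quotient.eq _).2 ?_
      have : f ≫ g - f' ≫ g' = (f - f') ≫ g + f' ≫ (g - g') := by simp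
      rw [this]
      exact add_mem (I.mem_comp hf g) (I.comp_mem f' hg))
  id_comp := by
    rintro X Y ⟨f⟩; exact congrArg Submodule.Quotient.mk (Category.id_comp f)
  comp_id := by
    rintro X Y ⟨f⟩; exact congrArg Submodule.Quotient.mk (Category.comp_id f)
  assoc := by
    rintro X Y Z W ⟨f⟩ ⟨g⟩ ⟨h⟩; exact congrArg Submodule.Quotient.mk (Category.assoc f g h)

/-- The class of a morphism in the quotient category. -/
def homMk (I : TensorIdeal C) {X Y : C} (f : X ⟶ Y) : (Quot.mk X : I.Quot) ⟶ Quot.mk Y :=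
  (Submodule.Quotient.mk f : (X ⟶ Y) ⧸ I.hom X Y)

instance : Preadditive I.Quot where
  homGroup X Y := inferInstanceAs (AddCommGroup ((X.as ⟶ Y.as) ⧸ I.hom X.as Y.as))
  add_comp := by
    rintro X Y Z ⟨f⟩ ⟨f'⟩ ⟨g⟩
    exact congrArg Submodule.Quotient.mk (Preadditive.add_comp _ _ _ f f' g)
  comp_add := by
    rintro X Y Z ⟨f⟩ ⟨g⟩ ⟨g'⟩
    exact congrArg Submodule.Quotient.mk (Preadditive.comp_add _ _ _ f g g')

instance : Linear ℂ I.Quot where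
  homModule X Y := inferInstanceAs (Module ℂ ((X.as ⟶ Y.as) ⧸ I.hom X.as Y.as))
  smul_comp := by
    rintro X Y Z c ⟨f⟩ ⟨g⟩
    exact congrArg Submodule.Quotient.mk (Linear.smul_comp _ _ _ c f g)
  comp_smul := by
    rintro X Y Z ⟨f⟩ c ⟨g⟩
    exact congrArg Submodule.Quotient.mk (Linear.comp_smul _ _ _ f c g)

/-- The projection onto the quotient. -/
def proj (I : TensorIdeal C) : C ⥤ I.Quot where
  obj X := ⟨X⟩
  map f := I.homMk f
  map_id _ := rfl
  map_comp _ _ := rfl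

/-- The functor out of the quotient induced by an additive functor that kills the ideal. -/
def descend (I : TensorIdeal C) {D : Type*} [Category* D] [Preadditive D] (F : C ⥤ D) [F.Additive]
    (h : ∀ {X Y : C} (f : X ⟶ Y), f ∈ I.hom X Y → F.map f = 0) : I.Quot ⥤ D where
  obj X := F.obj X.as
  map {X Y} f := Quotient.liftOn' f (fun f => F.map f) (by
    intro f g hfg
    rw [Submodule.quotientRel_def] at hfg
    have := h _ hfg
    rwa [F.map_sub, sub_eq_zero] at this)
  map_id X := F.map_id X.as
  map_comp := by rintro X Y Z ⟨f⟩ ⟨g⟩; exact F.map_comp f g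

instance (I : TensorIdeal C) {D : Type*} [Category* D] [Preadditive D] (F : C ⥤ D) [F.Additive]
    (h : ∀ {X Y : C} (f : X ⟶ Y), f ∈ I.hom X Y → F.map f = 0) : (I.descend F h).Additive where
  map_add := by rintro X Y ⟨f⟩ ⟨g⟩; exact F.map_add

end

section Monoidal

variable {C : Type w} [Category.{v} C] [Preadditive C] [Linear ℂ C] [MonoidalCategory C]
  [MonoidalPreadditive C] [MonoidalLinear ℂ C] {I : TensorIdeal C}

instance : MonoidalCategoryStruct I.Quot where
  tensorObj X Y := ⟨X.as ⊗ Y.as⟩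
  whiskerLeft X Y Z f := Quotient.liftOn' f (fun f => I.homMk (X.as ◁ f)) (by
      intro f g hfg
      rw [Submodule.quotientRel_def] at hfg
      refine (Submodule.Quotient.eq _).2 ?_
      rw [sub_eq_add_neg, ← neg_one_smul ℂ, ← MonoidalLinear.whiskerLeft_smul,
        ← MonoidalPreadditive.whiskerLeft_add, neg_one_smul, ← sub_eq_add_neg]
      exact I.whiskerLeft_mem X.as hfg)
  whiskerRight {Y Z} f X := Quotient.liftOn' f (fun f => I.homMk (f ▷ X.as)) (by
      intro f g hfg
      rw [Submodule.quotientRel_def] at hfg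
      refine (Submodule.Quotient.eq _).2 ?_
      rw [sub_eq_add_neg, ← neg_one_smul ℂ, ← MonoidalLinear.smul_whiskerRight,
        ← MonoidalPreadditive.add_whiskerRight, neg_one_smul, ← sub_eq_add_neg]
      exact I.whiskerRight_mem hfg X.as)
  tensorUnit := ⟨𝟙_ C⟩
  associator X Y Z := I.proj.mapIso (α_ X.as Y.as Z.as)
  leftUnitor X := I.proj.mapIso (λ_ X.as)
  rightUnitor X := I.proj.mapIso (ρ_ X.as)

instance : MonoidalCategory I.Quot where
  tensorHom_def _ _ := rfl
  id_tensorHom_id X Y := congrArg I.homMk (by simp : 𝟙 X.as ▷ Y.as ≫ X.as ◁ 𝟙 Y.as = 𝟙 _)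
  tensorHom_comp_tensorHom := by
    rintro X₁ Y₁ Z₁ X₂ Y₂ Z₂ ⟨f₁⟩ ⟨f₂⟩ ⟨g₁⟩ ⟨g₂⟩
    refine congrArg I.homMk (?_ : (f₁ ▷ _ ≫ _ ◁ f₂) ≫ (g₁ ▷ _ ≫ _ ◁ g₂) =
      (f₁ ≫ g₁) ▷ _ ≫ _ ◁ (f₂ ≫ g₂))
    simp only [← MonoidalCategory.tensorHom_def, MonoidalCategory.tensorHom_comp_tensorHom]
  whiskerLeft_id X Y := congrArg I.homMk (MonoidalCategory.whiskerLeft_id X.as Y.as)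
  id_whiskerRight X Y := congrArg I.homMk (MonoidalCategory.id_whiskerRight X.as Y.as)
  associator_naturality := by
    rintro X₁ X₂ X₃ Y₁ Y₂ Y₃ ⟨f₁⟩ ⟨f₂⟩ ⟨f₃⟩
    refine congrArg I.homMk (?_ : ((f₁ ▷ _ ≫ _ ◁ f₂) ▷ _ ≫ _ ◁ f₃) ≫ (α_ _ _ _).hom =
      (α_ _ _ _).hom ≫ (f₁ ▷ _ ≫ _ ◁ (f₂ ▷ _ ≫ _ ◁ f₃)))
    simp only [← MonoidalCategory.tensorHom_def, MonoidalCategory.associator_naturality]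
  leftUnitor_naturality := by
    rintro X Y ⟨f⟩; exact congrArg I.homMk (MonoidalCategory.leftUnitor_naturality f)
  rightUnitor_naturality := by
    rintro X Y ⟨f⟩; exact congrArg I.homMk (MonoidalCategory.rightUnitor_naturality f)
  pentagon W X Y Z :=
    congrArg I.homMk (MonoidalCategory.pentagon W.as X.as Y.as Z.as)
  triangle X Y := congrArg I.homMk (MonoidalCategory.triangle X.as Y.as)

end Monoidal

end TensorIdeal

/-! ### The diagrammatic category of a graph

A directed graph without multiple parallel edges, with nodes `I` and finitely many edges out of each
node, is given by `adj : I → Finset I`, where `b ∈ adj a` means that there is an edge from `a`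
to `b`.  It has two distinguished nodes `zero` and `one`. -/

section Dgrams

variable {I : Type u}

/-- The generating diagrams (identity strands are the identities of the category): for each edge from `a` to `b` a merge `one ⊗ a ⟶ b` and a split
`b ⟶ one ⊗ a`; and two diagrams which identify the strand labelled `zero` with the empty
diagram. -/
inductive DgramsGen (adj : I → Finset I) (zero one : I) : FreeObj I → FreeObj I → Type u
  | merge (a b : I) (h : b ∈ adj a) :
      DgramsGen adj zero one (.tensor (.of one) (.of a)) (.of b)
  | split (a b : I) (h : b ∈ adj a) :
      DgramsGen adj zero one (.of b) (.tensor (.of one) (.of a))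
  | erase : DgramsGen adj zero one (.of zero) .unit
  | create : DgramsGen adj zero one .unit (.of zero)

/-- The free `ℂ`-linear monoidal category on the generating diagrams. -/
abbrev FreeDgrams (adj : I → Finset I) (zero one : I) : Type u := FreeCat (DgramsGen adj zero one)

namespace FreeDgrams

variable (adj : I → Finset I) (zero one : I)

/-- The strand labelled `a`, as an object. -/
def node (a : I) : FreeDgrams adj zero one := FreeObj.of a

def merge (a b : I) (h : b ∈ adj a) :
    node adj zero one one ⊗ node adj zero one a ⟶ node adj zero one b :=
  FreeCat.homMk (.gen (.merge a b h))

def split (a b : I) (h : b ∈ adj a) :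
    node adj zero one b ⟶ node adj zero one one ⊗ node adj zero one a :=
  FreeCat.homMk (.gen (.split a b h))

def erase : node adj zero one zero ⟶ 𝟙_ (FreeDgrams adj zero one) :=
  FreeCat.homMk (.gen .erase)

def create : 𝟙_ (FreeDgrams adj zero one) ⟶ node adj zero one zero :=
  FreeCat.homMk (.gen .create)

/-- The defining relations, each written as a morphism that is set to zero. -/
inductive Relator : ∀ {X Y : FreeDgrams adj zero one}, (X ⟶ Y) → Prop
  | split_merge (a b : I) (h : b ∈ adj a) :
      Relator (split adj zero one a b h ≫ merge adj zero one a b h - 𝟙 (node adj zero one b))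
  | sum_merge_split (a : I) :
      Relator ((∑ b ∈ (adj a).attach,
          merge adj zero one a b.1 b.2 ≫ split adj zero one a b.1 b.2) -
        𝟙 (node adj zero one one ⊗ node adj zero one a))
  | erase_create : Relator (erase adj zero one ≫ create adj zero one - 𝟙 (node adj zero one zero))
  | create_erase : Relator (create adj zero one ≫ erase adj zero one - 𝟙 (𝟙_ _))

end FreeDgrams

/-- The diagrammatic category of a graph: the free `ℂ`-linear monoidal category on the generating
diagrams modulo the tensor ideal generated by the defining relations. -/
abbrev Dgrams (adj : I → Finset I) (zero one : I) : Type u :=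
  (TensorIdeal.span (FreeDgrams.Relator adj zero one)).Quot

/-- The generating object of the diagrammatic category labelled by `a`. -/
def Dgrams.node (adj : I → Finset I) (zero one a : I) : Dgrams adj zero one :=
  ⟨FreeDgrams.node adj zero one a⟩

/-- In the quotient by `J`, the space of morphisms between the generating objects `a` and `b`
is `ℂ · id` for `a = b` and `0` for `a ≠ b`. -/
def IsSchurLike {adj : I → Finset I} {zero one : I} (J : TensorIdeal (Dgrams adj zero one)) : Prop :=
  (∀ (a : I) (f : J.proj.obj (Dgrams.node adj zero one a) ⟶
      J.proj.obj (Dgrams.node adj zero one a)), ∃ c : ℂ, f = c • 𝟙 _) ∧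
  ∀ (a b : I) (f : J.proj.obj (Dgrams.node adj zero one a) ⟶
      J.proj.obj (Dgrams.node adj zero one b)), a ≠ b → f = 0

end Dgrams

/-! ### Representation graphs and the category of tensor products of simple modules -/

section Rep

variable {G : Type v} [Group G] {I : Type u}

instance : HasFiniteBiproducts (FDRep ℂ G) := HasFiniteBiproducts.of_hasFiniteProducts

/-- `m` is the edge multiplicity of the representation graph of `V` with nodes the modules `S a`:
`V ⊗ S a` is the direct sum over `b` of `m a b` copies of `S b`, and there are `m a b` edges
from `a` to `b`. -/
def IsRepresentationGraph (V : FDRep ℂ G) (S : I → FDRep ℂ G) (m : I → I →₀ ℕ) : Prop :=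
  ∀ a, Nonempty ((V ⊗ S a) ≅ ⨁ fun p : (Σ b : (m a).support, Fin (m a b)) => S p.1)

/-- No two nodes are joined by two or more edges with the same direction. -/
def NoMultipleEdges (m : I → I →₀ ℕ) : Prop := ∀ a b, m a b ≤ 1

/-- Connectedness of the graph.  For a finite graph this is connectedness of the underlying
undirected graph.  For an infinite graph, where the directions matter, it means that every node is
reached from the node `zero` along a directed path (for a graph in which every edge occurs in
both directions this is again connectedness of the underlying undirected graph). -/
def IsConnected (m : I → I →₀ ℕ) (zero : I) : Prop :=
  (Finite I → ∀ b, Relation.EqvGen (fun x y => m x y ≠ 0) zero b) ∧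
  (Infinite I → ∀ b, Relation.ReflTransGen (fun x y => m x y ≠ 0) zero b)

/-- The endpoints of the edges out of a node. -/
def outNeighbors (m : I → I →₀ ℕ) (a : I) : Finset I := (m a).support

/-- The finite tensor products (in any bracketing, the empty one included) of the modules `S a`. -/
inductive IsTensorProduct (S : I → FDRep ℂ G) : FDRep ℂ G → Prop
  | unit : IsTensorProduct S (𝟙_ (FDRep ℂ G))
  | of (a : I) : IsTensorProduct S (S a)
  | tensor {X Y : FDRep ℂ G} : IsTensorProduct S X → IsTensorProduct S Y →
      IsTensorProduct S (X ⊗ Y)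

/-- The full monoidal subcategory of the category of finite-dimensional `G`-modules generated by
the modules `S a`. -/
abbrev GModIrr (S : I → FDRep ℂ G) : Type _ :=
  ObjectProperty.FullSubcategory (IsTensorProduct S : ObjectProperty (FDRep ℂ G))

/-- A choice of a non-zero map `merge : S one ⊗ S a ⟶ S b` for each edge from `a` to `b`, together
with maps `split` in the opposite direction for which the sum of the composites is the
identity of `S one ⊗ S a`. -/
structure MergeSplit (S : I → FDRep ℂ G) (one : I) (adj : I → Finset I) where
  merge (a b : I) (h : b ∈ adj a) : S one ⊗ S a ⟶ S b
  split (a b : I) (h : b ∈ adj a) : S b ⟶ S one ⊗ S a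
  merge_ne_zero (a b : I) (h : b ∈ adj a) : merge a b h ≠ 0
  sum_merge_split (a : I) :
    ∑ b ∈ (adj a).attach, merge a b.1 b.2 ≫ split a b.1 b.2 = 𝟙 (S one ⊗ S a)

/-- The other defining relation follows from Schur's lemma. -/
theorem MergeSplit.split_merge {S : I → FDRep ℂ G} {one : I} {adj : I → Finset I}
    (hS : ∀ a, Simple (S a)) (hne : ∀ a b, Nonempty (S a ≅ S b) → a = b)
    (M : MergeSplit S one adj) (a b : I) (h : b ∈ adj a) :
    M.split a b h ≫ M.merge a b h = 𝟙 (S b) := by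
  have key : M.merge a b h ≫ M.split a b h ≫ M.merge a b h = M.merge a b h := by
    have h1 := congrArg (fun f => f ≫ M.merge a b h) (M.sum_merge_split a)
    simp only [Preadditive.sum_comp, Category.id_comp, Category.assoc] at h1
    rw [Finset.sum_eq_single (⟨b, h⟩ : {x // x ∈ adj a})] at h1
    · exact h1
    · rintro ⟨c, hc⟩ - hcb
      have hz : M.split a c hc ≫ M.merge a b h = 0 := by
        by_contra hnz
        have := hS c
        have := hS b
        have : IsIso (M.split a c hc ≫ M.merge a b h) := isIso_of_hom_simple hnz
        exact hcb (Subtype.ext (hne c b ⟨asIso (M.split a c hc ≫ M.merge a b h)⟩))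
      rw [hz, comp_zero]
    · intro hb
      exact absurd (Finset.mem_attach _ _) hb
  have := hS b
  have hnz : M.split a b h ≫ M.merge a b h ≠ 0 := by
    intro h0
    rw [h0, comp_zero] at key
    exact M.merge_ne_zero a b h key.symm
  have : IsIso (M.split a b h ≫ M.merge a b h) := isIso_of_hom_simple hnz
  have idem : (M.split a b h ≫ M.merge a b h) ≫ (M.split a b h ≫ M.merge a b h) =
      M.split a b h ≫ M.merge a b h := by
    rw [Category.assoc, key]
  rw [← cancel_epi (M.split a b h ≫ M.merge a b h), idem, Category.comp_id]

/-- The values on the generating diagrams of the functor to `G`-modules. -/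
def genMap {S : I → FDRep ℂ G} {zero one : I} {adj : I → Finset I} (M : MergeSplit S one adj)
    (e : S zero ≅ 𝟙_ (FDRep ℂ G)) :
    ∀ {X Y : FreeObj I}, DgramsGen adj zero one X Y → (FreeCat.liftObj S X ⟶ FreeCat.liftObj S Y)
  | _, _, .merge a b h => M.merge a b h
  | _, _, .split a b h => M.split a b h
  | _, _, .erase => e.hom
  | _, _, .create => e.inv

/-- The functor to `G`-modules on the free category. -/
def freeH {S : I → FDRep ℂ G} {zero one : I} {adj : I → Finset I} (M : MergeSplit S one adj)
    (e : S zero ≅ 𝟙_ (FDRep ℂ G)) : FreeDgrams adj zero one ⥤ FDRep ℂ G :=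
  FreeCat.lift S (genMap M e)

instance {S : I → FDRep ℂ G} {zero one : I} {adj : I → Finset I} (M : MergeSplit S one adj)
    (e : S zero ≅ 𝟙_ (FDRep ℂ G)) : (freeH M e).Additive :=
  inferInstanceAs (FreeCat.lift S (genMap M e)).Additive

/-- The morphisms killed by the functor on the free category form a tensor ideal. -/
def kerFreeH {S : I → FDRep ℂ G} {zero one : I} {adj : I → Finset I} (M : MergeSplit S one adj)
    (e : S zero ≅ 𝟙_ (FDRep ℂ G)) : TensorIdeal (FreeDgrams adj zero one) where
  hom X Y :=
    { carrier := {f | (freeH M e).map f = 0}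
      add_mem' := fun {f g} hf hg => by
        simp only [Set.mem_ofPred_eq] at hf hg ⊢
        rw [Functor.map_add, hf, hg, add_zero]
      zero_mem' := (freeH M e).map_zero X Y
      smul_mem' := fun c f hf => by
        obtain ⟨f⟩ := f
        exact (congrArg (fun g => c • g) hf).trans (smul_zero c) }
  comp_mem f g hg := by
    simp only [Submodule.mem_mk, AddSubmonoid.mem_mk, AddSubsemigroup.mem_mk,
      Set.mem_ofPred_eq] at hg ⊢
    rw [Functor.map_comp, hg, comp_zero]
  mem_comp hf g := by
    simp only [Submodule.mem_mk, AddSubmonoid.mem_mk, AddSubsemigroup.mem_mk,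
      Set.mem_ofPred_eq] at hf ⊢
    rw [Functor.map_comp, hf, zero_comp]
  whiskerLeft_mem X Y Z f hf := by
    have hw : (freeH M e).map (X ◁ f) = 𝟙 ((freeH M e).obj X) ⊗ₘ (freeH M e).map f := by
      obtain ⟨f⟩ := f; rfl
    have hf' : (freeH M e).map f = 0 := hf
    change (freeH M e).map (X ◁ f) = 0
    rw [hw, hf', MonoidalPreadditive.tensor_zero]; rfl
  whiskerRight_mem {Y Z f} hf X := by
    have hw : (freeH M e).map (f ▷ X) = (freeH M e).map f ⊗ₘ 𝟙 ((freeH M e).obj X) := by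
      obtain ⟨f⟩ := f; rfl
    have hf' : (freeH M e).map f = 0 := hf
    change (freeH M e).map (f ▷ X) = 0
    rw [hw, hf', MonoidalPreadditive.zero_tensor]; rfl

theorem freeH_relator {S : I → FDRep ℂ G} {zero one : I} {adj : I → Finset I}
    (hS : ∀ a, Simple (S a)) (hne : ∀ a b, Nonempty (S a ≅ S b) → a = b)
    (M : MergeSplit S one adj) (e : S zero ≅ 𝟙_ (FDRep ℂ G)) {X Y : FreeDgrams adj zero one}
    (f : X ⟶ Y) (hf : FreeDgrams.Relator adj zero one f) : (freeH M e).map f = 0 := by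
  cases hf with
  | split_merge a b h =>
      rw [Functor.map_sub, sub_eq_zero]
      exact M.split_merge hS hne a b h
  | sum_merge_split a =>
      rw [Functor.map_sub, sub_eq_zero, Functor.map_sum]
      exact M.sum_merge_split a
  | erase_create =>
      rw [Functor.map_sub, sub_eq_zero]
      exact e.hom_inv_id
  | create_erase =>
      rw [Functor.map_sub, sub_eq_zero]
      exact e.inv_hom_id

theorem freeH_span {S : I → FDRep ℂ G} {zero one : I} {adj : I → Finset I}
    (hS : ∀ a, Simple (S a)) (hne : ∀ a b, Nonempty (S a ≅ S b) → a = b)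
    (M : MergeSplit S one adj) (e : S zero ≅ 𝟙_ (FDRep ℂ G)) {X Y : FreeDgrams adj zero one}
    (f : X ⟶ Y) (hf : f ∈ (TensorIdeal.span (FreeDgrams.Relator adj zero one)).hom X Y) :
    (freeH M e).map f = 0 :=
  TensorIdeal.mem_of_mem_span (kerFreeH M e) (fun f hf => freeH_relator hS hne M e f hf) hf

theorem isTensorProduct_liftObj (S : I → FDRep ℂ G) (X : FreeObj I) :
    IsTensorProduct S (FreeCat.liftObj S X) := by
  induction X with
  | unit => exact .unit
  | of a => exact .of a
  | tensor X Y hX hY => exact .tensor hX hY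

/-- The `ℂ`-linear monoidal functor `H` from the diagrammatic category to the category of tensor
products of the `S a`: it sends the node `a` to `S a`, formal tensor products to tensor
products, the merge and split diagrams to the chosen maps, and identifies the node `zero` with
the trivial module through `e`. -/
def functorH {S : I → FDRep ℂ G} {zero one : I} {adj : I → Finset I}
    (hS : ∀ a, Simple (S a)) (hne : ∀ a b, Nonempty (S a ≅ S b) → a = b)
    (M : MergeSplit S one adj) (e : S zero ≅ 𝟙_ (FDRep ℂ G)) :
    Dgrams adj zero one ⥤ GModIrr S :=
  ObjectProperty.lift _ (TensorIdeal.descend _ (freeH M e) (freeH_span hS hne M e))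
    (fun X => isTensorProduct_liftObj S X.as)

instance {S : I → FDRep ℂ G} {zero one : I} {adj : I → Finset I}
    (hS : ∀ a, Simple (S a)) (hne : ∀ a b, Nonempty (S a ≅ S b) → a = b)
    (M : MergeSplit S one adj) (e : S zero ≅ 𝟙_ (FDRep ℂ G)) :
    (functorH hS hne M e).Additive where
  map_add {X Y f g} := by
    apply ObjectProperty.hom_ext
    exact (TensorIdeal.descend _ (freeH M e) (freeH_span hS hne M e)).map_add

/-- The functor induced by `H` on the quotient by a tensor ideal that `H` kills. -/
def inducedH {S : I → FDRep ℂ G} {zero one : I} {adj : I → Finset I}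
    (hS : ∀ a, Simple (S a)) (hne : ∀ a b, Nonempty (S a ≅ S b) → a = b)
    (M : MergeSplit S one adj) (e : S zero ≅ 𝟙_ (FDRep ℂ G))
    (J : TensorIdeal (Dgrams adj zero one))
    (hJ : ∀ {X Y : Dgrams adj zero one} (f : X ⟶ Y), f ∈ J.hom X Y →
      (functorH hS hne M e).map f = 0) :
    J.Quot ⥤ GModIrr S :=
  J.descend (functorH hS hne M e) hJ

end Rep

end RepDiagrams

end

/-!
Write `Q` for the quotient category. Every bracketed tensor product of the `S a` is the image of a
formal one, so the induced functor is essentially surjective (`inducedH_essSurj`). It is bijective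
on morphisms between nodes: on the side of `Q` these spaces are known by assumption, on the side of
`G`-modules by Schur's lemma. To pass to all morphisms, it is enough that the identity of every
object is a sum of morphisms that factor through nodes (`faithful_of_isSummand`,
`full_of_isSummand`).

Such a decomposition exists for the powers `1 ⊗ (1 ⊗ (⋯ ⊗ 𝟙_))`, by repeated use of the relation
`∑ b, merge ≫ split = 𝟙` and of the identification of the node `zero` with the unit. If there is a
directed path from `zero` to a node, the splits and merges along it make the node a retract of such
a power, since `split ≫ merge = 𝟙`. If all nodes are reached, every tensor product of nodes is
therefore a retract of a power of `1`, and inherits a decomposition (`Dgrams.isSummand`).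

For an infinite graph directed paths from `zero` are part of the assumption. For a finite graph,
connected in the undirected sense, they come from representation theory (`MergeSplit.reachable`):
a set `R` of nodes closed under outgoing edges is closed under incoming edges. Let `A` be the span
of the matrix coefficients of the `S r`, `r ∈ R`. It is finite-dimensional and stable under
multiplication by the matrix coefficients of `V = S one`. Hence `u ↦ (g ↦ u g ∘ ρ g)`, with `ρ` the
action on `V`, maps the finite-dimensional space of functions from `G` to the dual of `V` with
coordinates in `A` injectively, hence bijectively, to itself. For a non-zero map
`p : V ⊗ W ⟶ S r` the function `g ↦ φ (p (- ⊗ g w))` is sent by this operation into that space, so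
it lies there. Thus the matrix coefficients `g ↦ φ (p (v ⊗ g w))` of the simple module `W` are in
`A`, and `W` embeds into a sum of copies of the `S r`, so that it is one of them
(`exists_iso_of_tensor_hom`).
-/

namespace RepDiagrams

/-! ### Sums of morphisms that factor through a family of objects -/

section Factor

variable {C : Type*} [Category* C] [Preadditive C] {ι : Type*} (N : ι → C)

/-- The sums of morphisms `X ⟶ Y` that factor through one of the objects `N a`. -/
def factorsThrough (X Y : C) : AddSubgroup (X ⟶ Y) :=
  AddSubgroup.closure {h | ∃ (a : ι) (f : X ⟶ N a) (g : N a ⟶ Y), f ≫ g = h}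

variable {N}

theorem comp_mem_factorsThrough {a : ι} {X Y : C} (f : X ⟶ N a) (g : N a ⟶ Y) :
    f ≫ g ∈ factorsThrough N X Y :=
  AddSubgroup.subset_closure ⟨a, f, g, rfl⟩

theorem factorsThrough_comp {X Y Z : C} {p : X ⟶ Y} (hp : p ∈ factorsThrough N X Y) (q : Y ⟶ Z) :
    p ≫ q ∈ factorsThrough N X Z := by
  refine AddSubgroup.closure_induction ?_ ?_ ?_ ?_ hp
  · rintro _ ⟨a, f, g, rfl⟩
    rw [Category.assoc]
    exact comp_mem_factorsThrough _ _
  · rw [zero_comp]; exact zero_mem _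
  · intro x y _ _ hx hy
    rw [Preadditive.add_comp]; exact add_mem hx hy
  · intro x _ hx
    rw [Preadditive.neg_comp]; exact neg_mem hx

theorem comp_factorsThrough {X Y Z : C} (p : X ⟶ Y) {q : Y ⟶ Z} (hq : q ∈ factorsThrough N Y Z) :
    p ≫ q ∈ factorsThrough N X Z := by
  refine AddSubgroup.closure_induction ?_ ?_ ?_ ?_ hq
  · rintro _ ⟨a, f, g, rfl⟩
    rw [← Category.assoc]
    exact comp_mem_factorsThrough _ _
  · rw [comp_zero]; exact zero_mem _
  · intro x y _ _ hx hy
    rw [Preadditive.comp_add]; exact add_mem hx hy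
  · intro x _ hx
    rw [Preadditive.comp_neg]; exact neg_mem hx

variable (N) in
/-- The identity of `X` is a sum of morphisms through the objects `N a`; in the additive
completion, `X` is then a direct summand of a direct sum of objects `N a`. -/
def IsSummand (X : C) : Prop := 𝟙 X ∈ factorsThrough N X X

theorem IsSummand.of_retract {X Y : C} (h : Retract X Y) (hY : IsSummand N Y) :
    IsSummand N X := by
  have := comp_factorsThrough h.i (factorsThrough_comp hY h.r)
  rwa [Category.id_comp, h.retract] at this

theorem isSummand_self (a : ι) : IsSummand N (N a) := by
  have := comp_mem_factorsThrough (N := N) (𝟙 (N a)) (𝟙 (N a))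
  rwa [Category.comp_id] at this

/-- An additive functor `F` sends a sum of morphisms through the `N a` to a sum of morphisms through
the `F.obj (N a)`, which factor further through the second family `N'`. -/
theorem IsSummand.map {D : Type*} [Category* D] [Preadditive D] (F : C ⥤ D) [F.Additive]
    {κ : Type*} {N' : κ → D} (hN : ∀ a, IsSummand N' (F.obj (N a))) {X : C}
    (hX : IsSummand N X) : IsSummand N' (F.obj X) := by
  suffices ∀ p ∈ factorsThrough N X X, F.map p ∈ factorsThrough N' (F.obj X) (F.obj X) by
    have h := this _ hX
    rwa [F.map_id] at h
  intro p hp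
  refine AddSubgroup.closure_induction ?_ ?_ ?_ ?_ hp
  · rintro _ ⟨a, f, g, rfl⟩
    have := comp_factorsThrough (F.map f) (factorsThrough_comp (hN a) (F.map g))
    rwa [Category.id_comp, ← F.map_comp] at this
  · rw [F.map_zero]; exact zero_mem _
  · intro x y _ _ hx hy
    rw [F.map_add]; exact add_mem hx hy
  · intro x _ hx
    rw [F.map_neg]; exact neg_mem hx

variable {D : Type*} [Category* D] [Preadditive D] (F : C ⥤ D) [F.Additive]

/-- If all identities of `C` are sums of morphisms through the `N a`, faithfulness of an additive
functor can be tested on morphisms between the `N a`: cut a morphism with the identities on both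
sides. -/
theorem faithful_of_isSummand (hN : ∀ X, IsSummand N X)
    (hF : ∀ (a b : ι) (f : N a ⟶ N b), F.map f = 0 → f = 0) : F.Faithful := by
  refine ⟨fun {X Y f f'} hff' => ?_⟩
  rw [← sub_eq_zero] at hff' ⊢
  rw [← F.map_sub] at hff'
  generalize f - f' = k at hff'
  suffices ∀ p ∈ factorsThrough N X X, ∀ q ∈ factorsThrough N Y Y, p ≫ k ≫ q = 0 by
    simpa using this _ (hN X) _ (hN Y)
  intro p hp q hq
  refine AddSubgroup.closure_induction ?_ (by simp) ?_ ?_ hp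
  · rintro _ ⟨a, f, g, rfl⟩
    refine AddSubgroup.closure_induction ?_ (by simp) ?_ ?_ hq
    · rintro _ ⟨b, f', g', rfl⟩
      have := hF a b (g ≫ k ≫ f') (by simp [hff'])
      calc (f ≫ g) ≫ k ≫ f' ≫ g' = f ≫ (g ≫ k ≫ f') ≫ g' := by simp
        _ = 0 := by simp [this]
    · intro x y _ _ hx hy
      rw [Preadditive.comp_add, Preadditive.comp_add, hx, hy, add_zero]
    · intro x _ hx
      rw [Preadditive.comp_neg, Preadditive.comp_neg, hx, neg_zero]
  · intro x y _ _ hx hy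
    rw [Preadditive.add_comp, hx, hy, add_zero]
  · intro x _ hx
    rw [Preadditive.neg_comp, hx, neg_zero]

/-- Like faithfulness, fullness of an additive functor can be tested on morphisms between the
`N a`. -/
theorem full_of_isSummand (hN : ∀ X, IsSummand N X)
    (hF : ∀ (a b : ι) (h : F.obj (N a) ⟶ F.obj (N b)), ∃ f, F.map f = h) : F.Full := by
  refine ⟨fun {X Y} h => ?_⟩
  suffices ∀ p ∈ factorsThrough N X X, ∀ q ∈ factorsThrough N Y Y,
      F.map p ≫ h ≫ F.map q ∈ (F.mapAddHom : (X ⟶ Y) →+ _).range by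
    simpa using this _ (hN X) _ (hN Y)
  intro p hp q hq
  refine AddSubgroup.closure_induction ?_ (by simp) ?_ ?_ hp
  · rintro _ ⟨a, f, g, rfl⟩
    refine AddSubgroup.closure_induction ?_ (by simp) ?_ ?_ hq
    · rintro _ ⟨b, f', g', rfl⟩
      obtain ⟨k, hk⟩ := hF a b (F.map g ≫ h ≫ F.map f')
      exact ⟨f ≫ k ≫ g', by simp [hk]⟩
    · intro x y _ _ hx hy
      rw [F.map_add, Preadditive.comp_add, Preadditive.comp_add]; exact add_mem hx hy
    · intro x _ hx
      rw [F.map_neg, Preadditive.comp_neg, Preadditive.comp_neg]; exact neg_mem hx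
  · intro x y _ _ hx hy
    rw [F.map_add, Preadditive.add_comp]; exact add_mem hx hy
  · intro x _ hx
    rw [F.map_neg, Preadditive.neg_comp]; exact neg_mem hx

end Factor

/-! ### Decomposition of the objects of the diagrammatic category -/

namespace TensorIdeal

variable {C : Type w} [Category.{v} C] [Preadditive C] [Linear ℂ C] [MonoidalCategory C]

instance (J : TensorIdeal C) : J.proj.Additive where
  map_add := rfl

instance [MonoidalPreadditive C] [MonoidalLinear ℂ C] (J : TensorIdeal C) :
    MonoidalPreadditive J.Quot where
  whiskerLeft_zero {X Y Z} := congrArg J.homMk (MonoidalPreadditive.whiskerLeft_zero)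
  zero_whiskerRight {X Y Z} := congrArg J.homMk (MonoidalPreadditive.zero_whiskerRight)
  whiskerLeft_add := by
    rintro X Y Z ⟨f⟩ ⟨g⟩; exact congrArg J.homMk (MonoidalPreadditive.whiskerLeft_add f g)
  add_whiskerRight := by
    rintro X Y Z ⟨f⟩ ⟨g⟩; exact congrArg J.homMk (MonoidalPreadditive.add_whiskerRight f g)

end TensorIdeal

section Monoidal

variable {C : Type*} [Category* C] [MonoidalCategory C]

/-- The power `V ⊗ (V ⊗ (⋯ ⊗ 𝟙_ C))`. -/
def tensorPow (V : C) : ℕ → C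
  | 0 => 𝟙_ C
  | n + 1 => V ⊗ tensorPow V n

/-- Powers multiply by adding exponents. -/
def tensorPowAdd (V : C) (k : ℕ) : ∀ n, tensorPow V n ⊗ tensorPow V k ≅ tensorPow V (n + k)
  | 0 => λ_ _ ≪≫ eqToIso (by rw [Nat.zero_add])
  | n + 1 => α_ _ _ _ ≪≫ whiskerLeftIso V (tensorPowAdd V k n) ≪≫
      eqToIso (by rw [Nat.succ_add]; rfl)

/-- Tensor products of retracts are retracts. -/
def retractTensor {X X' Y Y' : C} (h : Retract X X') (h' : Retract Y Y') :
    Retract (X ⊗ Y) (X' ⊗ Y') where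
  i := h.i ⊗ₘ h'.i
  r := h.r ⊗ₘ h'.r

end Monoidal

namespace Dgrams

variable {I : Type u} {adj : I → Finset I} {zero one : I}

/-- By the relation `∑ b, merge ≫ split = 𝟙`. -/
theorem isSummand_one_tensor (a : I) :
    IsSummand (node adj zero one) (node adj zero one one ⊗ node adj zero one a) := by
  have key : 𝟙 (node adj zero one one ⊗ node adj zero one a) =
      ∑ b ∈ (adj a).attach,
        TensorIdeal.homMk _ (FreeDgrams.merge adj zero one a b.1 b.2) ≫
          TensorIdeal.homMk _ (FreeDgrams.split adj zero one a b.1 b.2) := by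
    have h := (Submodule.Quotient.eq _).2 (TensorIdeal.mem_span_of
      (FreeDgrams.Relator.sum_merge_split (adj := adj) (zero := zero) (one := one) a))
    refine h.symm.trans ?_
    exact ((TensorIdeal.span (FreeDgrams.Relator adj zero one)).proj.map_sum _ _)
  unfold IsSummand
  rw [key]
  exact sum_mem fun b _ => comp_mem_factorsThrough (N := node adj zero one) (a := b.1) _ _

/-- The node `b` is a retract of `1 ⊗ a` if there is an edge from `a` to `b`. -/
def retractOfEdge {a b : I} (h : b ∈ adj a) :
    Retract (node adj zero one b) (node adj zero one one ⊗ node adj zero one a) where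
  i := TensorIdeal.homMk _ (FreeDgrams.split adj zero one a b h)
  r := TensorIdeal.homMk _ (FreeDgrams.merge adj zero one a b h)
  retract := (Submodule.Quotient.eq _).2
    (TensorIdeal.mem_span_of (FreeDgrams.Relator.split_merge a b h))

/-- The node `zero` is isomorphic to the unit. -/
def nodeZeroIso : node adj zero one zero ≅ 𝟙_ (Dgrams adj zero one) where
  hom := TensorIdeal.homMk _ (FreeDgrams.erase adj zero one)
  inv := TensorIdeal.homMk _ (FreeDgrams.create adj zero one)
  hom_inv_id := (Submodule.Quotient.eq _).2 (TensorIdeal.mem_span_of .erase_create)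
  inv_hom_id := (Submodule.Quotient.eq _).2 (TensorIdeal.mem_span_of .create_erase)

theorem isSummand_tensorPow (n : ℕ) :
    IsSummand (node adj zero one) (tensorPow (node adj zero one one) n) := by
  induction n with
  | zero => exact (isSummand_self zero).of_retract (Retract.ofIso nodeZeroIso.symm)
  | succ n ih => exact ih.map (tensorLeft (node adj zero one one)) isSummand_one_tensor

theorem exists_retract_node_tensorPow {a : I}
    (h : Relation.ReflTransGen (fun x y => y ∈ adj x) zero a) :
    ∃ n, Nonempty (Retract (node adj zero one a) (tensorPow (node adj zero one one) n)) := by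
  induction h with
  | refl => exact ⟨0, ⟨Retract.ofIso nodeZeroIso⟩⟩
  | tail _ hbc ih =>
    obtain ⟨n, ⟨r⟩⟩ := ih
    exact ⟨n + 1, ⟨(retractOfEdge hbc).trans (r.map (tensorLeft _))⟩⟩

/-- If every node is reached from `zero`, all objects are retracts of powers of the node `one`. -/
theorem exists_retract_tensorPow
    (h : ∀ a, Relation.ReflTransGen (fun x y => y ∈ adj x) zero a) (X : Dgrams adj zero one) :
    ∃ n, Nonempty (Retract X (tensorPow (node adj zero one one) n)) := by
  obtain ⟨X⟩ := X
  induction X with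
  | unit => exact ⟨0, ⟨Retract.refl _⟩⟩
  | of a => exact exists_retract_node_tensorPow (h a)
  | tensor X Y hX hY =>
    obtain ⟨n, ⟨r⟩⟩ := hX
    obtain ⟨k, ⟨s⟩⟩ := hY
    exact ⟨n + k, ⟨(retractTensor r s).trans (Retract.ofIso (tensorPowAdd _ k n))⟩⟩

/-- If every node is reached from `zero`, the identity of every object is a sum of morphisms through
nodes. -/
theorem isSummand (h : ∀ a, Relation.ReflTransGen (fun x y => y ∈ adj x) zero a)
    (X : Dgrams adj zero one) : IsSummand (node adj zero one) X := by
  obtain ⟨n, ⟨r⟩⟩ := exists_retract_tensorPow h X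
  exact (isSummand_tensorPow n).of_retract r

end Dgrams

/-! ### Simple objects and irreducible representations -/

section Linearize

open Representation
open scoped MonoidAlgebra

variable {G : Type v} [Group G]

/-- The linear map underlying a morphism of representations. -/
def toLin {X Y : FDRep ℂ G} (f : X ⟶ Y) : X →ₗ[ℂ] Y := f.hom.hom.hom

theorem toLin_rho {X Y : FDRep ℂ G} (f : X ⟶ Y) (g : G) (x : X) :
    toLin f (X.ρ g x) = Y.ρ g (toLin f x) :=
  ConcreteCategory.congr_hom (f.comm g) x

theorem toLin_injective {X Y : FDRep ℂ G} : Function.Injective (toLin (X := X) (Y := Y)) := by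
  intro f f' h
  ext x
  exact LinearMap.congr_fun h x

/-- The action on `X`, as a `Representation`. -/
noncomputable abbrev rep (X : FDRep ℂ G) : Representation ℂ G X := X.ρ

/-- An intertwining map as a morphism of `FDRep`. -/
def ofIntertwining {X Y : FDRep ℂ G} (f : IntertwiningMap (rep X) (rep Y)) : X ⟶ Y where
  hom := FGModuleCat.ofHom f.toLinearMap
  comm g := by
    ext x
    exact IntertwiningMap.isIntertwining _ _ f g x

/-- A simple object of `FDRep ℂ G` has no proper non-zero subrepresentations. -/
theorem isIrreducible_of_simple (X : FDRep ℂ G) [Simple X] : IsIrreducible (rep X) := by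
  have hid : 𝟙 X ≠ 0 := id_nonzero X
  have hnt : Nontrivial X := by
    by_contra h
    rw [not_nontrivial_iff_subsingleton] at h
    exact hid (toLin_injective (LinearMap.ext fun x => Subsingleton.elim _ _))
  refine { exists_pair_ne := ⟨⊥, ⊤, fun h => ?_⟩, eq_bot_or_eq_top := fun U => ?_ }
  · have := congrArg Subrepresentation.toSubmodule h
    exact bot_ne_top (α := Submodule ℂ X) this
  · -- the inclusion of a subrepresentation is a monomorphism into a simple object
    let i : FDRep.of U.toRepresentation ⟶ X :=
      ⟨FGModuleCat.ofHom U.toSubmodule.subtype, fun g => by ext x; rfl⟩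
    have hi : Function.Injective (toLin i) := Subtype.val_injective
    have : Mono i := ⟨fun a b hab => toLin_injective (LinearMap.ext fun x => hi
      (LinearMap.congr_fun (congrArg toLin hab) x))⟩
    by_cases h0 : i = 0
    · left
      apply Subrepresentation.toSubmodule_injective
      refine (Submodule.eq_bot_iff _).2 fun x hx => ?_
      exact LinearMap.congr_fun (congrArg toLin h0) ⟨x, hx⟩
    · right
      have : IsIso i := isIso_of_mono_of_nonzero h0
      apply Subrepresentation.toSubmodule_injective
      refine (Submodule.eq_top_iff').2 fun x => ?_
      have h : (toLin (inv i) x : U.toSubmodule).1 = x :=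
        LinearMap.congr_fun (congrArg toLin (IsIso.inv_hom_id i)) x
      exact h ▸ (toLin (inv i) x : U.toSubmodule).2

theorem iso_of_linearEquiv {X Y : FDRep ℂ G} [Simple X] [Simple Y]
    (e : (rep X).asModule ≃ₗ[ℂ[G]] (rep Y).asModule) : Nonempty (X ≅ Y) := by
  let f : X ⟶ Y := ofIntertwining
    ((IntertwiningMap.equivLinearMapAsModule (rep X) (rep Y)).symm e.toLinearMap)
  have hf : f ≠ 0 := by
    intro h
    refine id_nonzero X (toLin_injective (LinearMap.ext fun x => e.injective ?_))
    exact (LinearMap.congr_fun (congrArg toLin h) x).trans (map_zero e).symm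
  have := isIso_of_hom_simple hf
  exact ⟨asIso f⟩

/-! ### Matrix coefficients -/

/-- The action of `G` on the functions on `G` by right translation. -/
def translationRep (G : Type v) [Group G] : Representation ℂ G (G → ℂ) where
  toFun h := LinearMap.funLeft ℂ ℂ (· * h)
  map_one' := by ext f g; simp
  map_mul' h k := by ext f g; simp [mul_assoc]

/-- A linear form `φ` on `X` determines the map of representations which sends `x` to the matrix
coefficient `g ↦ φ (g x)`. -/
noncomputable def coeffMap (X : FDRep ℂ G) (φ : X →ₗ[ℂ] ℂ) :
    IntertwiningMap (rep X) (translationRep G) where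
  toLinearMap := LinearMap.pi fun g => φ ∘ₗ X.ρ g
  isIntertwining' h := by
    ext x g
    simp [translationRep]

theorem coeffMap_apply (X : FDRep ℂ G) (φ : X →ₗ[ℂ] ℂ) (x : X) (g : G) :
    coeffMap X φ x g = φ (X.ρ g x) := rfl

/-- `coeffMap` as a linear map over the group algebra. -/
noncomputable def coeffLin (X : FDRep ℂ G) (φ : X →ₗ[ℂ] ℂ) :
    (rep X).asModule →ₗ[ℂ[G]] (translationRep G).asModule :=
  IntertwiningMap.equivLinearMapAsModule _ _ (coeffMap X φ)

theorem coeffLin_injective (X : FDRep ℂ G) [Simple X] {φ : X →ₗ[ℂ] ℂ} (hφ : φ ≠ 0) :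
    Function.Injective (coeffLin X φ) := by
  have := isIrreducible_of_simple X
  refine (LinearMap.injective_or_eq_zero (coeffLin X φ)).resolve_right fun h => hφ ?_
  ext x
  have h1 : φ (X.ρ 1 x) = 0 := congrFun (LinearMap.congr_fun h x : (coeffLin X φ x : G → ℂ) = 0) 1
  rwa [map_one] at h1

variable {κ : Type*} (T : κ → FDRep ℂ G)

/-- The span of the matrix coefficients of the representations `T k`. -/
def coeffSpan : Submodule ℂ (G → ℂ) :=
  Submodule.span ℂ {f | ∃ k φ x, coeffMap (T k) φ x = f}

variable {T}

theorem coeffMap_mem (k : κ) (φ : T k →ₗ[ℂ] ℂ) (x : T k) : coeffMap (T k) φ x ∈ coeffSpan T :=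
  Submodule.subset_span ⟨k, φ, x, rfl⟩

/-- A simple representation whose matrix coefficients, for one non-zero linear form, are among
those of the simple representations `T k` is isomorphic to one of them: the functions on `G`
contain it as a simple submodule of a sum of copies of the `T k`. -/
theorem exists_iso_of_coeffMap_mem [∀ k, Simple (T k)] (W : FDRep ℂ G) [Simple W]
    {χ : W →ₗ[ℂ] ℂ} (hχ : χ ≠ 0) (h : ∀ w, coeffMap W χ w ∈ coeffSpan T) :
    ∃ k, Nonempty (W ≅ T k) := by
  have := isIrreducible_of_simple W
  have := fun k => isIrreducible_of_simple (T k)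
  let s : Set (Submodule ℂ[G] (translationRep G).asModule) :=
    {N | ∃ k φ, φ ≠ 0 ∧ N = LinearMap.range (coeffLin (T k) φ)}
  have hs : ∀ N : s, IsSimpleModule ℂ[G] N := by
    rintro ⟨_, k, φ, hφ, rfl⟩
    exact IsSimpleModule.congr (LinearEquiv.ofInjective _ (coeffLin_injective (T k) hφ)).symm
  let eW := LinearEquiv.ofInjective _ (coeffLin_injective W hχ)
  have : IsSimpleModule ℂ[G] (LinearMap.range (coeffLin W χ)) := IsSimpleModule.congr eW.symm
  have hle : coeffSpan T ≤ (sSup s).restrictScalars ℂ := by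
    refine Submodule.span_le.2 ?_
    rintro _ ⟨k, φ, x, rfl⟩
    by_cases hφ : φ = 0
    · have : coeffMap (T k) φ x = 0 := by
        ext g
        rw [coeffMap_apply, hφ]; rfl
      rw [this]
      exact zero_mem _
    · exact (le_sSup (show LinearMap.range (coeffLin (T k) φ) ∈ s from ⟨k, φ, hφ, rfl⟩))
        ⟨x, rfl⟩
  obtain ⟨_, ⟨k, φ, hφ, rfl⟩, ⟨e⟩⟩ :=
    Submodule.linearEquiv_of_le_sSup (LinearMap.range (coeffLin W χ)) s (by
      rintro _ ⟨w, rfl⟩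
      exact hle (h w))
  exact ⟨k, iso_of_linearEquiv ((eW.trans e).trans
    (LinearEquiv.ofInjective _ (coeffLin_injective (T k) hφ)).symm)⟩

instance [Finite κ] : FiniteDimensional ℂ (coeffSpan T) := by
  -- every matrix coefficient `g ↦ φ (g x)` is a linear form on `End (T k)` applied to the action
  let L (k : κ) : ((T k →ₗ[ℂ] T k) →ₗ[ℂ] ℂ) →ₗ[ℂ] (G → ℂ) :=
    LinearMap.pi fun g => LinearMap.applyₗ ((T k).ρ g)
  have hle : coeffSpan T ≤ ⨆ k, LinearMap.range (L k) := by
    refine Submodule.span_le.2 ?_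
    rintro _ ⟨k, φ, x, rfl⟩
    exact (le_iSup (fun k => LinearMap.range (L k)) k) ⟨φ ∘ₗ LinearMap.applyₗ x, rfl⟩
  exact Submodule.finiteDimensional_of_le hle

theorem coeffMap_mem_of_isSummand {X : FDRep ℂ G} (hX : IsSummand T X) (φ : X →ₗ[ℂ] ℂ) (x : X) :
    coeffMap X φ x ∈ coeffSpan T := by
  suffices ∀ p ∈ factorsThrough T X X, coeffMap X (φ ∘ₗ toLin p) x ∈ coeffSpan T from this _ hX
  intro p hp
  refine AddSubgroup.closure_induction ?_ ?_ ?_ ?_ hp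
  · rintro _ ⟨k, f, f', rfl⟩
    convert coeffMap_mem k (φ ∘ₗ toLin f') (toLin f x) using 1
    ext g
    exact congrArg (fun y => φ (toLin f' y)) (toLin_rho f g x)
  · convert zero_mem (coeffSpan T) using 1
    ext g
    exact map_zero φ
  · intro p q _ _ hp hq
    convert add_mem hp hq using 1
    ext g
    exact map_add φ _ _
  · intro p _ hp
    convert neg_mem hp using 1
    ext g
    exact map_neg φ _

/-- The product of matrix coefficients of `V` and `T k` is a matrix coefficient of `V ⊗ T k`. -/
theorem coeffMap_mul_mem {V : FDRep ℂ G} (hV : ∀ k, IsSummand T (V ⊗ T k)) (ψ : V →ₗ[ℂ] ℂ) (v : V)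
    {f : G → ℂ} (hf : f ∈ coeffSpan T) : coeffMap V ψ v * f ∈ coeffSpan T := by
  refine (Submodule.span_le (p := (coeffSpan T).comap (LinearMap.mulLeft ℂ (coeffMap V ψ v)))).2
    ?_ hf
  rintro _ ⟨k, φ, x, rfl⟩
  have h := coeffMap_mem_of_isSummand (hV k)
    (LinearMap.mul' ℂ ℂ ∘ₗ TensorProduct.map ψ φ) (v ⊗ₜ[ℂ] x)
  exact h

/-- The functions `u` from `G` to the dual of `V` all of whose coordinates are matrix coefficients
of the `T k`. -/
def dualValued (T : κ → FDRep ℂ G) (V : FDRep ℂ G) : Submodule ℂ (G → (V →ₗ[ℂ] ℂ)) where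
  carrier := {u | ∀ v, (fun g => u g v) ∈ coeffSpan T}
  add_mem' hu hu' v := add_mem (hu v) (hu' v)
  zero_mem' _ := zero_mem (coeffSpan T)
  smul_mem' c _ hu v := Submodule.smul_mem _ c (hu v)

instance [Finite κ] (V : FDRep ℂ G) : FiniteDimensional ℂ (dualValued T V) := by
  let b := Module.finBasis ℂ V
  let L : dualValued T V →ₗ[ℂ] (Fin (Module.finrank ℂ V) → coeffSpan T) :=
    { toFun u i := ⟨fun g => u.1 g (b i), u.2 (b i)⟩
      map_add' _ _ := rfl
      map_smul' _ _ := rfl }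
  refine FiniteDimensional.of_injective L fun u u' h =>
    Subtype.ext (funext fun g => b.ext fun i => ?_)
  exact congrFun (congrArg Subtype.val (congrFun h i)) g

/-- Precomposition with the action, on functions from `G` to the dual of `V`. -/
noncomputable def twist (V : FDRep ℂ G) : (G → (V →ₗ[ℂ] ℂ)) →ₗ[ℂ] (G → (V →ₗ[ℂ] ℂ)) where
  toFun u g := u g ∘ₗ V.ρ g
  map_add' _ _ := rfl
  map_smul' _ _ := rfl

theorem twist_injective (V : FDRep ℂ G) : Function.Injective (twist V) := by
  intro u u' h
  ext g v
  have := LinearMap.congr_fun (congrFun h g) (V.ρ g⁻¹ v)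
  have hv : V.ρ g (V.ρ g⁻¹ v) = v := by
    rw [← Module.End.mul_apply, ← map_mul, mul_inv_cancel, map_one]; rfl
  simpa [twist, hv] using this

theorem twist_mem {V : FDRep ℂ G} (hV : ∀ k, IsSummand T (V ⊗ T k)) {u : G → (V →ₗ[ℂ] ℂ)}
    (hu : u ∈ dualValued T V) : twist V u ∈ dualValued T V := by
  intro v
  let b := Module.finBasis ℂ V
  have key : (fun g => twist V u g v) =
      ∑ i, coeffMap V (b.coord i) v * fun g => u g (b i) := by
    ext g
    rw [Finset.sum_apply]
    change u g (V.ρ g v) = ∑ i, b.coord i (V.ρ g v) * u g (b i)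
    conv_lhs => rw [← b.sum_repr (V.ρ g v), map_sum]
    simp only [map_smul, smul_eq_mul, Module.Basis.coord_apply]
  rw [key]
  exact sum_mem fun i _ => coeffMap_mul_mem hV _ _ (hu (b i))

/-- The inverse of `twist` also preserves the finite-dimensional space `dualValued T V`; in this
way the matrix coefficients of the dual of `V` are under control. -/
theorem mem_of_twist_mem [Finite κ] {V : FDRep ℂ G} (hV : ∀ k, IsSummand T (V ⊗ T k))
    {u : G → (V →ₗ[ℂ] ℂ)} (hu : twist V u ∈ dualValued T V) : u ∈ dualValued T V := by
  let L := (twist V).restrict (p := dualValued T V) (q := dualValued T V) fun _ => twist_mem hV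
  have hinj : Function.Injective L := fun x y h =>
    Subtype.ext (twist_injective V (congrArg Subtype.val h))
  obtain ⟨⟨u', hu'⟩, h⟩ := LinearMap.surjective_of_injective hinj ⟨_, hu⟩
  rwa [← twist_injective V (congrArg Subtype.val h)]

/-- A finite family of simple representations that is stable under tensoring with `V` contains every
simple representation `W` for which `V ⊗ W` maps to a member of the family. -/
theorem exists_iso_of_tensor_hom [Finite κ] [∀ k, Simple (T k)] {V : FDRep ℂ G}
    (hV : ∀ k, IsSummand T (V ⊗ T k)) {W : FDRep ℂ G} [Simple W] {k : κ} (p : V ⊗ W ⟶ T k)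
    (hp : p ≠ 0) : ∃ k, Nonempty (W ≅ T k) := by
  let P : V →ₗ[ℂ] W →ₗ[ℂ] T k := TensorProduct.curry (toLin p)
  have hP : ∀ (g : G) (v : V) (w : W), P (V.ρ g v) (W.ρ g w) = (T k).ρ g (P v w) :=
    fun g v w => toLin_rho p g (v ⊗ₜ[ℂ] w)
  obtain ⟨v, w, hvw⟩ : ∃ v w, P v w ≠ 0 := by
    by_contra! h
    exact hp (toLin_injective (TensorProduct.ext' h))
  obtain ⟨φ, hφ⟩ : ∃ φ : T k →ₗ[ℂ] ℂ, φ (P v w) ≠ 0 := by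
    by_contra! h
    exact hvw ((Module.forall_dual_apply_eq_zero_iff ℂ _).1 h)
  refine exists_iso_of_coeffMap_mem W (χ := φ ∘ₗ P v) (fun h => hφ (LinearMap.congr_fun h w))
    fun w => ?_
  -- twisting `g ↦ φ (p (- ⊗ g w))` gives `g ↦ φ (p (g - ⊗ g w)) = φ (g p (- ⊗ w))`
  have : (fun g => φ ∘ₗ P.flip (W.ρ g w)) ∈ dualValued T V := by
    refine mem_of_twist_mem hV fun v => ?_
    convert coeffMap_mem k φ (P v w) using 1
    ext g
    exact congrArg φ (hP g v w)
  exact this v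

end Linearize

/-! ### Reachability in the representation graph -/

section Main

variable {G : Type v} [Group G] {I : Type u} {S : I → FDRep ℂ G} {one : I} {adj : I → Finset I}

/-- For a set `R` of nodes closed under outgoing edges, the simple modules in `R` are stable under
tensoring with `S one`. -/
theorem MergeSplit.isSummand (M : MergeSplit S one adj) {R : I → Prop}
    (hR : ∀ a b, R a → b ∈ adj a → R b) (a : I) (ha : R a) :
    IsSummand (fun r : Subtype R => S r) (S one ⊗ S a) := by
  unfold IsSummand
  rw [← M.sum_merge_split a]
  exact sum_mem fun b _ => comp_mem_factorsThrough (N := fun r : Subtype R => S r)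
    (a := ⟨b.1, hR a b.1 ha b.2⟩) _ _

/-- In a finite graph, a set of nodes that is closed under outgoing edges is also closed under
incoming edges. -/
theorem MergeSplit.closed_incoming [Finite I] (hS : ∀ a, Simple (S a))
    (hne : ∀ a b, Nonempty (S a ≅ S b) → a = b) (M : MergeSplit S one adj) {R : I → Prop}
    (hR : ∀ a b, R a → b ∈ adj a → R b) {a b : I} (hab : b ∈ adj a) (hb : R b) : R a := by
  obtain ⟨⟨r, hr⟩, h⟩ := exists_iso_of_tensor_hom (T := fun r : Subtype R => S r)
    (fun k => M.isSummand hR k.1 k.2) (k := ⟨b, hb⟩) (M.merge a b hab) (M.merge_ne_zero a b hab)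
  exact hne a r h ▸ hr

/-- Connectedness gives directed paths from `zero` to all nodes, also for finite graphs, where it
only refers to undirected paths. -/
theorem MergeSplit.reachable {m : I → I →₀ ℕ} {zero : I} (hS : ∀ a, Simple (S a))
    (hne : ∀ a b, Nonempty (S a ≅ S b) → a = b) (M : MergeSplit S one (outNeighbors m))
    (hconn : IsConnected m zero) (a : I) :
    Relation.ReflTransGen (fun x y => y ∈ outNeighbors m x) zero a := by
  have hrel : (fun x y => m x y ≠ 0) = fun x y => y ∈ outNeighbors m x := by
    ext x y
    exact Finsupp.mem_support_iff.symm
  unfold IsConnected at hconn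
  rw [hrel] at hconn
  rcases finite_or_infinite I with hI | hI
  · have key : ∀ x y, Relation.EqvGen (fun x y => y ∈ outNeighbors m x) x y →
        (Relation.ReflTransGen (fun x y => y ∈ outNeighbors m x) zero x ↔
          Relation.ReflTransGen (fun x y => y ∈ outNeighbors m x) zero y) := by
      intro x y h
      induction h with
      | rel x y h =>
        exact ⟨fun hx => hx.tail h,
          M.closed_incoming hS hne (fun _ _ hx hxy => hx.tail hxy) h⟩
      | refl x => rfl
      | symm x y _ ih => exact ih.symm
      | trans x y z _ _ ih ih' => exact ih.trans ih'
    exact (key _ _ (hconn.1 hI a)).1 .refl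
  · exact hconn.2 hI a

/-! ### The induced functor on nodes and on objects -/

variable {zero : I} (hS : ∀ a, Simple (S a)) (hne : ∀ a b, Nonempty (S a ≅ S b) → a = b)
  (M : MergeSplit S one adj) (e : S zero ≅ 𝟙_ (FDRep ℂ G))
  (J : TensorIdeal (Dgrams adj zero one))
  (hJ : ∀ {X Y : Dgrams adj zero one} (f : X ⟶ Y), f ∈ J.hom X Y → (functorH hS hne M e).map f = 0)

instance : (inducedH hS hne M e J hJ).Additive :=
  inferInstanceAs (J.descend (functorH hS hne M e) hJ).Additive

theorem inducedH_smul_id (c : ℂ) (X : J.Quot) :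
    ((inducedH hS hne M e J hJ).map (c • 𝟙 X)).hom =
      c • 𝟙 ((inducedH hS hne M e J hJ).obj X).obj := rfl

/-- Every bracketing of a tensor product of the modules `S a` is the image of a formal tensor
product. -/
theorem exists_liftObj_eq {X : FDRep ℂ G} (hX : IsTensorProduct S X) :
    ∃ Y : FreeObj I, FreeCat.liftObj S Y = X := by
  induction hX with
  | unit => exact ⟨.unit, rfl⟩
  | of a => exact ⟨.of a, rfl⟩
  | tensor _ _ ihX ihY =>
    obtain ⟨X, rfl⟩ := ihX
    obtain ⟨Y, rfl⟩ := ihY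
    exact ⟨.tensor X Y, rfl⟩

theorem inducedH_essSurj : (inducedH hS hne M e J hJ).EssSurj where
  mem_essImage := by
    rintro ⟨X, hX⟩
    obtain ⟨Y, rfl⟩ := exists_liftObj_eq hX
    exact ⟨⟨⟨Y⟩⟩, ⟨Iso.refl _⟩⟩

variable {J}

/-- A multiple `c • 𝟙` is killed only for `c = 0`, as `S a` is not zero. -/
theorem inducedH_injective_node (hSchur : IsSchurLike J) (a b : I)
    (f : J.proj.obj (Dgrams.node adj zero one a) ⟶ J.proj.obj (Dgrams.node adj zero one b))
    (hf : (inducedH hS hne M e J hJ).map f = 0) : f = 0 := by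
  by_cases hab : a = b
  · subst hab
    obtain ⟨c, rfl⟩ := hSchur.1 a f
    have h : c • 𝟙 (S a) = 0 := (inducedH_smul_id hS hne M e J hJ c _).symm.trans
      (congrArg InducedCategory.Hom.hom hf)
    have := hS a
    rw [(smul_eq_zero.1 h).resolve_right (id_nonzero _), zero_smul]
  · exact hSchur.2 a b f hab

/-- By Schur's lemma for the modules `S a`. -/
theorem inducedH_surjective_node (a b : I)
    (h : (inducedH hS hne M e J hJ).obj (J.proj.obj (Dgrams.node adj zero one a)) ⟶
      (inducedH hS hne M e J hJ).obj (J.proj.obj (Dgrams.node adj zero one b))) :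
    ∃ f, (inducedH hS hne M e J hJ).map f = h := by
  have := hS a
  have := hS b
  by_cases hab : a = b
  · subst hab
    obtain ⟨c, hc⟩ := endomorphism_simple_eq_smul_id ℂ (X := S a) h.hom
    exact ⟨c • 𝟙 _, ObjectProperty.hom_ext _
      ((inducedH_smul_id hS hne M e J hJ c _).trans hc)⟩
  · refine ⟨0, ?_⟩
    rw [Functor.map_zero]
    refine ObjectProperty.hom_ext _ (Eq.symm ?_)
    by_contra h0
    have : IsIso (X := S a) (Y := S b) h.hom := isIso_of_hom_simple h0
    exact hab (hne a b ⟨asIso (X := S a) (Y := S b) h.hom⟩)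

end Main

end RepDiagrams

theorem mainTheorem3 {G : Type v} [Group G] {I : Type u}
    (S : I → FDRep ℂ G)
    (hS : ∀ a, Simple (S a))
    (hne : ∀ a b, Nonempty (S a ≅ S b) → a = b)
    (zero one : I)
    (e : S zero ≅ 𝟙_ (FDRep ℂ G))
    (m : I → I →₀ ℕ)
    (hm : RepDiagrams.IsRepresentationGraph (S one) S m)
    (hmult : RepDiagrams.NoMultipleEdges m)
    (hconn : RepDiagrams.IsConnected m zero)
    (M : RepDiagrams.MergeSplit S one (RepDiagrams.outNeighbors m))
    (J : RepDiagrams.TensorIdeal (RepDiagrams.Dgrams (RepDiagrams.outNeighbors m) zero one))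
    (hJ : ∀ {X Y : RepDiagrams.Dgrams (RepDiagrams.outNeighbors m) zero one} (f : X ⟶ Y),
      f ∈ J.hom X Y → (RepDiagrams.functorH hS hne M e).map f = 0)
    (hSchur : RepDiagrams.IsSchurLike J) :
    (RepDiagrams.inducedH hS hne M e J hJ).IsEquivalence := by
  have hN (X : J.Quot) : RepDiagrams.IsSummand (fun a => J.proj.obj
      (RepDiagrams.Dgrams.node (RepDiagrams.outNeighbors m) zero one a)) X :=
    (RepDiagrams.Dgrams.isSummand (M.reachable hS hne hconn) X.as).map J.proj
      fun a => RepDiagrams.isSummand_self a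
  have := RepDiagrams.faithful_of_isSummand (RepDiagrams.inducedH hS hne M e J hJ) hN
    (RepDiagrams.inducedH_injective_node hS hne M e hJ hSchur)
  have := RepDiagrams.full_of_isSummand (RepDiagrams.inducedH hS hne M e J hJ) hN
    (RepDiagrams.inducedH_surjective_node hS hne M e hJ)
  have := RepDiagrams.inducedH_essSurj hS hne M e J hJ
  exact {}
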